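/- Let $\mathcal O$ be a complete discrete valuation ring with fraction field of characteristic $0$ and finite residue field $k$ of cardinality $q=p^h$, $p$ prime, and fix a uniformizer $\pi$ of $\mathcal O$. For an $\mathcal O$-algebra $B$ let $W_{\mathcal O}(B)$ be the $\mathcal O$-algebra of ramified Witt vectors: the set $B^{\mathbb N_0}$ with the $\mathcal O$-algebra structure, functorial in $B$, for which the maps $\Phi_n\colon W_{\mathcal O}(B)\to B$, $\Phi_n(b_0,b_1,\dots)=b_0^{q^n}+\pi b_1^{q^{n-1}}+\dots+\pi^n b_n$ $(n\ge 0)$, are homomorphisms of $\mathcal O$-algebras. Let $W(B)$ be the ring of $p$-typical Witt vectors, with Witt polynomials $w_n(b_0,b_1,\dots)=b_0^{p^n}+p\,b_1^{p^{n-1}}+\dots+p^n b_n$, and let $u_B\colon W(B)\to W_{\mathcal O}(B)$ be Drinfeld's map, i.e. the ring homomorphism, functorial in the $\mathcal O$-algebra $B$, such that $\Phi_n(u_B(\boldsymbol b))=w_{nh}(\boldsymbol b)$ for all $n\ge 0$ and $\boldsymbol b\in W(B)$. Regard $\mathcal O$ as a $W(k)$-algebra via the unique ring homomorphism $W(k)\to\mathcal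 O$ that induces the identity on the residue field $k$. For a $k$-algebra $A$ (an $\mathcal O$-algebra via $\mathcal O\to k$) the map $u_A$ is $W(k)$-linear; let \[ r_A\colon W(A)\otimes_{W(k)}\mathcal O\to W_{\mathcal O}(A),\qquad x\otimes c\mapsto c\cdot u_A(x), \] be the induced homomorphism of $\mathcal O$-algebras. Then for every $k$-algebra $A$: (1) if $A$ is reduced, then $r_A$ is injective; (2) if $A$ is semiperfect, i.e. the Frobenius $a\mapsto a^p$ of $A$ is surjective, then $r_A$ is surjective; (3) if $A$ is perfect, i.e. the Frobenius of $A$ is bijective, then $r_A$ is bijective. In particular, the structure map $\mathcal O\to W_{\mathcal O}(k)$ is an isomorphism. -/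

import Mathlib

open IsLocalRing

set_option linter.unusedSectionVars false

/-! ## Ghost components and Dwork's lemma -/

section Ghost

variable {P : Type*} [CommRing P]

/-- The ghost components `Φ_n(b) = b_0^(q^n) + ϖ b_1^(q^(n-1)) + ⋯ + ϖ^n b_n` of a sequence. -/
def ghostSeq (ϖ : P) (q : ℕ) (b : ℕ → P) (n : ℕ) : P :=
  ∑ i ∈ Finset.range (n + 1), ϖ ^ i * b i ^ q ^ (n - i)

/-- The sequence obtained by solving `Φ_n(b) = a_n` recursively for `b_n`.
It does solve these equations under the congruences of `ghostSeq_ghostLift`,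
and the solution is unique if `ϖ` is not a zero divisor (`ghostSeq_injective`). -/
noncomputable def ghostLift (ϖ : P) (q : ℕ) (a : ℕ → P) : ℕ → P
  | n => Classical.epsilon fun c : P =>
      a n = ∑ i : Fin n, ϖ ^ (i : ℕ) * ghostLift ϖ q a i ^ q ^ (n - (i : ℕ)) + ϖ ^ n * c

theorem dvd_pow_sub_pow {ϖ a b : P} {t : ℕ} (ht : ϖ ∣ (t : P)) (h : ϖ ∣ a - b) (n : ℕ) :
    ϖ ^ (n + 1) ∣ a ^ t ^ n - b ^ t ^ n := by
  have := SModEq.pow_pow_add_one (I := Ideal.span {ϖ}) (p := t)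
    (Ideal.mem_span_singleton.2 ht) (x := a) (y := b)
    (SModEq.sub_mem.2 (Ideal.mem_span_singleton.2 h)) n
  rw [SModEq.sub_mem, Ideal.span_singleton_pow, Ideal.mem_span_singleton] at this
  exact this

theorem ghostSeq_eq_add (ϖ : P) (q : ℕ) (b : ℕ → P) (n : ℕ) :
    ghostSeq ϖ q b n =
      ∑ i ∈ Finset.range n, ϖ ^ i * b i ^ q ^ (n - i) + ϖ ^ n * b n := by
  simp [ghostSeq, Finset.sum_range_succ]

theorem ghostSeq_ghostLift {ϖ : P} {q : ℕ} (hq : ϖ ∣ (q : P)) (σ : P →+* P) (hϖ : σ ϖ = ϖ)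
    (hσ : ∀ b, ϖ ∣ σ b - b ^ q) {a : ℕ → P}
    (ha : ∀ n, ϖ ^ (n + 1) ∣ σ (a n) - a (n + 1)) (n : ℕ) :
    ghostSeq ϖ q (ghostLift ϖ q a) n = a n := by
  have key : ∀ n, (∃ c, a n = ∑ i : Fin n,
      ϖ ^ (i : ℕ) * ghostLift ϖ q a i ^ q ^ (n - (i : ℕ)) + ϖ ^ n * c) →
      ghostSeq ϖ q (ghostLift ϖ q a) n = a n := by
    intro n h
    rw [ghostSeq_eq_add, ← Fin.sum_univ_eq_sum_range
      (fun i => ϖ ^ i * ghostLift ϖ q a i ^ q ^ (n - i)) n]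
    have := Classical.epsilon_spec h
    rw [← ghostLift] at this
    exact this.symm
  induction n with
  | zero => exact key 0 ⟨a 0, by simp⟩
  | succ n ih =>
    apply key
    suffices h : ϖ ^ (n + 1) ∣ a (n + 1) - ∑ i : Fin (n + 1),
        ϖ ^ (i : ℕ) * ghostLift ϖ q a i ^ q ^ (n + 1 - (i : ℕ)) by
      obtain ⟨c, hc⟩ := h
      exact ⟨c, by rw [← hc]; ring⟩
    rw [Fin.sum_univ_eq_sum_range (fun i => ϖ ^ i * ghostLift ϖ q a i ^ q ^ (n + 1 - i)) (n + 1)]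
    have h1 : ϖ ^ (n + 1) ∣ σ (a n) - ∑ i ∈ Finset.range (n + 1),
        ϖ ^ i * ghostLift ϖ q a i ^ q ^ (n + 1 - i) := by
      rw [← ih, ghostSeq, map_sum, ← Finset.sum_sub_distrib]
      refine Finset.dvd_sum fun i hi => ?_
      have hi' : i ≤ n := Nat.lt_succ_iff.1 (Finset.mem_range.1 hi)
      have e1 : n + 1 = i + (n - i + 1) := by omega
      have e2 : n + 1 - i = 1 + (n - i) := by omega
      rw [map_mul, map_pow, map_pow, hϖ, ← mul_sub, e2, pow_add q, pow_one, pow_mul]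
      nth_rw 1 [e1]
      rw [pow_add ϖ i]
      exact mul_dvd_mul_left _ (dvd_pow_sub_pow hq (hσ _) _)
    have := dvd_sub h1 (ha n)
    rwa [show σ (a n) - (∑ i ∈ Finset.range (n + 1),
      ϖ ^ i * ghostLift ϖ q a i ^ q ^ (n + 1 - i)) - (σ (a n) - a (n + 1)) =
      a (n + 1) - ∑ i ∈ Finset.range (n + 1),
        ϖ ^ i * ghostLift ϖ q a i ^ q ^ (n + 1 - i) by ring] at this

theorem ghostSeq_injective {ϖ : P} (hϖ : ∀ x : P, ϖ * x = 0 → x = 0) (q : ℕ) :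
    Function.Injective (ghostSeq ϖ q) := by
  have hpow : ∀ (n : ℕ) (x : P), ϖ ^ n * x = 0 → x = 0 := by
    intro n
    induction n with
    | zero => intro x h; simpa using h
    | succ n ih => intro x h; rw [pow_succ, mul_assoc] at h; exact hϖ _ (ih _ h)
  intro b c h
  funext n
  induction n using Nat.strong_induction_on with
  | _ n ih =>
    have hn := congrFun h n
    rw [ghostSeq_eq_add, ghostSeq_eq_add, Finset.sum_congr rfl
      (fun i hi => by rw [ih i (Finset.mem_range.1 hi)])] at hn
    exact sub_eq_zero.1 (hpow n _ (by rw [mul_sub]; exact sub_eq_zero.2 (add_left_cancel hn)))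

/-- Sequences whose ghost components agree modulo `ϖ^(n+1)` agree modulo `ϖ`. -/
theorem dvd_sub_of_ghostSeq [IsDomain P] {ϖ : P} (hϖ : ϖ ≠ 0) {q : ℕ} (hq : ϖ ∣ (q : P))
    {b c : ℕ → P} (h : ∀ n, ϖ ^ (n + 1) ∣ ghostSeq ϖ q b n - ghostSeq ϖ q c n) (n : ℕ) :
    ϖ ∣ b n - c n := by
  induction n using Nat.strong_induction_on with
  | _ n ih =>
    have h1 : ϖ ^ (n + 1) ∣ ∑ i ∈ Finset.range n, ϖ ^ i * b i ^ q ^ (n - i) -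
        ∑ i ∈ Finset.range n, ϖ ^ i * c i ^ q ^ (n - i) := by
      rw [← Finset.sum_sub_distrib]
      refine Finset.dvd_sum fun i hi => ?_
      have hi' := Finset.mem_range.1 hi
      rw [← mul_sub, show n + 1 = i + (n - i + 1) by omega, pow_add ϖ i]
      exact mul_dvd_mul_left _ (dvd_pow_sub_pow hq (ih i hi') _)
    have h2 := dvd_sub (h n) h1
    rw [ghostSeq_eq_add, ghostSeq_eq_add, show ∀ s t x y : P, s + x - (t + y) - (s - t) = x - y by
      intros; ring, ← mul_sub, pow_succ] at h2
    exact (mul_dvd_mul_iff_left (pow_ne_zero n hϖ)).1 h2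

theorem map_ghostSeq {Q : Type*} [CommRing Q] (f : P →+* Q) (ϖ : P) (q : ℕ) (b : ℕ → P) (n : ℕ) :
    f (ghostSeq ϖ q b n) = ghostSeq (f ϖ) q (fun i => f (b i)) n := by
  simp [ghostSeq]

end Ghost

/-! ## Arithmetic of a discrete valuation ring with finite residue field -/

section Residue

variable {O : Type*} [CommRing O] [IsDomain O] [IsDiscreteValuationRing O]

/-- The number of elements of the residue field. -/
noncomputable def residueCard (O : Type*) [CommRing O] [IsLocalRing O] : ℕ :=
  Nat.card (ResidueField O)

theorem residueCard_pos (O : Type*) [CommRing O] [IsLocalRing O] [Finite (ResidueField O)] :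
    0 < residueCard O := Nat.card_pos

/-- The number `h` such that the residue field has `p ^ h` elements. -/
noncomputable def residueDegree (O : Type*) [CommRing O] [IsLocalRing O] (p : ℕ) : ℕ :=
  Nat.log p (residueCard O)

theorem dvd_iff_residue_eq_zero {π : O} (hπ : Irreducible π) (x : O) :
    π ∣ x ↔ residue O x = 0 := by
  rw [residue_eq_zero_iff, hπ.maximalIdeal_eq, Ideal.mem_span_singleton]

theorem exists_residueCard_eq (O : Type*) [CommRing O] [IsLocalRing O]
    [Finite (ResidueField O)] (p : ℕ) [Fact p.Prime] [CharP (ResidueField O) p] :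
    ∃ n, 0 < n ∧ residueCard O = p ^ n := by
  have := Fintype.ofFinite (ResidueField O)
  obtain ⟨n, -, hn⟩ := FiniteField.card (ResidueField O) p
  exact ⟨n, n.pos, by rw [residueCard, Nat.card_eq_fintype_card, hn]⟩

theorem residueCard_eq (O : Type*) [CommRing O] [IsLocalRing O]
    [Finite (ResidueField O)] (p : ℕ) [hp : Fact p.Prime] [CharP (ResidueField O) p] :
    residueCard O = p ^ residueDegree O p := by
  obtain ⟨n, -, hn⟩ := exists_residueCard_eq O p
  rw [residueDegree, hn, Nat.log_pow hp.out.one_lt]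

theorem residueDegree_pos (O : Type*) [CommRing O] [IsLocalRing O]
    [Finite (ResidueField O)] (p : ℕ) [hp : Fact p.Prime] [CharP (ResidueField O) p] :
    0 < residueDegree O p := by
  obtain ⟨n, h, hn⟩ := exists_residueCard_eq O p
  rwa [residueDegree, hn, Nat.log_pow hp.out.one_lt]

theorem dvd_prime {π : O} (hπ : Irreducible π) (p : ℕ) [CharP (ResidueField O) p] :
    π ∣ (p : O) := by
  rw [dvd_iff_residue_eq_zero hπ, map_natCast, CharP.cast_eq_zero]

theorem dvd_residueCard [Finite (ResidueField O)] {π : O} (hπ : Irreducible π) : π ∣ (residueCard O : O) := by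
  have := Fintype.ofFinite (ResidueField O)
  rw [dvd_iff_residue_eq_zero hπ, map_natCast, residueCard, Nat.card_eq_fintype_card,
    Nat.cast_card_eq_zero]

theorem dvd_sub_pow_residueCard [Finite (ResidueField O)] {π : O} (hπ : Irreducible π) (x : O) :
    π ∣ x - x ^ residueCard O := by
  have := Fintype.ofFinite (ResidueField O)
  rw [dvd_iff_residue_eq_zero hπ, map_sub, map_pow, residueCard, Nat.card_eq_fintype_card,
    FiniteField.pow_card, sub_self]

open MvPolynomial in
/-- On a polynomial ring over `O`, the endomorphism `X_i ↦ X_i ^ q` lifts the `q`-Frobenius. -/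
theorem dvd_expand_sub_pow [Finite (ResidueField O)] {π : O} (hπ : Irreducible π) {ι : Type*} (f : MvPolynomial ι O) :
    algebraMap O (MvPolynomial ι O) π ∣ expand (residueCard O) f - f ^ residueCard O := by
  obtain ⟨p, hchar⟩ := CharP.exists (ResidueField O)
  have : Fact p.Prime := ⟨CharP.char_is_prime (ResidueField O) p⟩
  obtain ⟨n, -, hn⟩ := exists_residueCard_eq O p
  induction f using MvPolynomial.induction_on with
  | C a =>
    rw [expand_C, ← C_pow, ← C_sub, algebraMap_eq]
    exact map_dvd C (dvd_sub_pow_residueCard hπ a)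
  | add f g hf hg =>
    obtain ⟨r, hr⟩ := exists_add_pow_prime_pow_eq (R := MvPolynomial ι O)
      (Fact.out : p.Prime) f g n
    have hp : algebraMap O (MvPolynomial ι O) π ∣ (p : MvPolynomial ι O) := by
      rw [← map_natCast (algebraMap O (MvPolynomial ι O))]
      exact map_dvd _ (dvd_prime hπ p)
    rw [hn] at hf hg ⊢
    rw [map_add, hr, show ∀ a b c d e : MvPolynomial ι O,
      a + b - (c + d + e) = (a - c) + (b - d) - e by intros; ring]
    refine dvd_sub (dvd_add hf hg) ?_
    rw [mul_assoc, mul_assoc]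
    exact hp.mul_right _
  | mul_X f i hf =>
    rw [map_mul, expand_X, mul_pow, ← sub_mul]
    exact hf.mul_right _

theorem mvPolynomial_eq_zero_of_mul {π : O} (hπ : Irreducible π) {ι : Type*}
    (x : MvPolynomial ι O) (h : algebraMap O (MvPolynomial ι O) π * x = 0) : x = 0 := by
  refine (mul_eq_zero.1 h).resolve_left fun h0 => hπ.ne_zero ?_
  exact MvPolynomial.C_injective ι O (by simpa using h0)

theorem ghostSeq_ghostLift_mvPolynomial [Finite (ResidueField O)] {π : O} (hπ : Irreducible π) {ι : Type*}
    {a : ℕ → MvPolynomial ι O}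
    (ha : ∀ n, algebraMap O (MvPolynomial ι O) π ^ (n + 1) ∣
      MvPolynomial.expand (residueCard O) (a n) - a (n + 1)) (n : ℕ) :
    ghostSeq (algebraMap O _ π) (residueCard O)
      (ghostLift (algebraMap O _ π) (residueCard O) a) n = a n := by
  have h1 : algebraMap O (MvPolynomial ι O) π ∣ (residueCard O : MvPolynomial ι O) := by
    rw [← map_natCast (algebraMap O (MvPolynomial ι O))]
    exact map_dvd _ (dvd_residueCard hπ)
  have h2 : ((MvPolynomial.expand (residueCard O) : MvPolynomial ι O →ₐ[O] MvPolynomial ι O) :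
      MvPolynomial ι O →+* MvPolynomial ι O)
      (algebraMap O _ π) = algebraMap O _ π := (MvPolynomial.expand _).commutes π
  exact ghostSeq_ghostLift h1 _ h2 (dvd_expand_sub_pow hπ) ha n

end Residue

/-! ## Ramified Witt vectors -/

/-- The set `B^ℕ` underlying the ramified Witt vectors over `O` (with uniformizer `π`) with
coefficients in `B`. -/
@[ext]
structure RamifiedWittVector {O : Type*} (π : O) (B : Type*) where
  coeff : ℕ → B

namespace RamifiedWittVector

variable {O : Type*} [CommRing O] [IsDomain O] [IsDiscreteValuationRing O] (π : O)

/-- The ghost component `Φ_n(b) = b_0^(q^n) + π b_1^(q^(n-1)) + ⋯ + π^n b_n`, where `q` is the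
cardinality of the residue field of `O`. -/
noncomputable def ghost {π : O} {B : Type*} [CommRing B] [Algebra O B]
    (b : RamifiedWittVector π B) (n : ℕ) : B :=
  ghostSeq (algebraMap O B π) (residueCard O) b.coeff n

/-- The ghost components of the generic vector with coordinates `X (f 0), X (f 1), …`. -/
noncomputable def genericGhost {ι : Type*} (f : ℕ → ι) (n : ℕ) : MvPolynomial ι O :=
  ghostSeq (algebraMap O _ π) (residueCard O) (fun i => MvPolynomial.X (f i)) n

/-- The polynomials over `O` whose ghost components are the given ones. -/
noncomputable def structurePoly {ι : Type*} (a : ℕ → MvPolynomial ι O) : ℕ → MvPolynomial ι O :=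
  ghostLift (algebraMap O _ π) (residueCard O) a

/-- The polynomials giving the sum of two vectors, determined by
`Φ_n(S_0, S_1, …) = Φ_n(X) + Φ_n(Y)`. -/
noncomputable def addPoly : ℕ → MvPolynomial (ℕ ⊕ ℕ) O :=
  structurePoly π fun n => genericGhost π Sum.inl n + genericGhost π Sum.inr n

/-- The polynomials giving the product of two vectors, determined by
`Φ_n(M_0, M_1, …) = Φ_n(X) * Φ_n(Y)`. -/
noncomputable def mulPoly : ℕ → MvPolynomial (ℕ ⊕ ℕ) O :=
  structurePoly π fun n => genericGhost π Sum.inl n * genericGhost π Sum.inr n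

/-- The polynomials giving the opposite of a vector, determined by
`Φ_n(N_0, N_1, …) = - Φ_n(X)`. -/
noncomputable def negPoly : ℕ → MvPolynomial ℕ O :=
  structurePoly π fun n => - genericGhost π id n

/-- The vector in `O^ℕ` with all ghost components equal to `c`. -/
noncomputable def constSeq (c : O) : ℕ → O :=
  ghostLift π (residueCard O) fun _ => c

section Operations

variable {π} {B : Type*} [CommRing B] [Algebra O B]

instance : Zero (RamifiedWittVector π B) := ⟨⟨fun _ => 0⟩⟩

instance : One (RamifiedWittVector π B) := ⟨⟨fun n => if n = 0 then 1 else 0⟩⟩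

noncomputable instance : Add (RamifiedWittVector π B) :=
  ⟨fun x y => ⟨fun n => MvPolynomial.aeval (Sum.elim x.coeff y.coeff) (addPoly π n)⟩⟩

noncomputable instance : Mul (RamifiedWittVector π B) :=
  ⟨fun x y => ⟨fun n => MvPolynomial.aeval (Sum.elim x.coeff y.coeff) (mulPoly π n)⟩⟩

noncomputable instance : Neg (RamifiedWittVector π B) :=
  ⟨fun x => ⟨fun n => MvPolynomial.aeval x.coeff (negPoly π n)⟩⟩

/-- The map induced on vectors by a map of coefficients. -/
def mapFun {B C : Type*} (f : B → C) (x : RamifiedWittVector π B) : RamifiedWittVector π C :=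
  ⟨fun n => f (x.coeff n)⟩

theorem mapFun_surjective {B C : Type*} {f : B → C} (hf : Function.Surjective f) :
    Function.Surjective (mapFun f : RamifiedWittVector π B → RamifiedWittVector π C) := by
  intro y
  choose g hg using hf
  exact ⟨⟨fun n => g (y.coeff n)⟩, by ext n; exact hg _⟩

variable {C : Type*} [CommRing C] [Algebra O C] (f : B →ₐ[O] C)

theorem mapFun_zero : mapFun f (0 : RamifiedWittVector π B) = 0 := by
  ext n; exact map_zero f

theorem mapFun_one : mapFun f (1 : RamifiedWittVector π B) = 1 := by
  ext n
  change f (if n = 0 then 1 else 0) = if n = 0 then 1 else 0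
  split_ifs <;> simp

theorem mapFun_add (x y : RamifiedWittVector π B) :
    mapFun f (x + y) = mapFun f x + mapFun f y := by
  ext n
  change f (MvPolynomial.aeval _ _) = MvPolynomial.aeval _ _
  rw [← AlgHom.comp_apply, MvPolynomial.comp_aeval]
  congr 2
  funext i
  cases i <;> rfl

theorem mapFun_mul (x y : RamifiedWittVector π B) :
    mapFun f (x * y) = mapFun f x * mapFun f y := by
  ext n
  change f (MvPolynomial.aeval _ _) = MvPolynomial.aeval _ _
  rw [← AlgHom.comp_apply, MvPolynomial.comp_aeval]
  congr 2
  funext i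
  cases i <;> rfl

theorem mapFun_neg (x : RamifiedWittVector π B) : mapFun f (-x) = -mapFun f x := by
  ext n
  change f (MvPolynomial.aeval _ _) = MvPolynomial.aeval _ _
  rw [← AlgHom.comp_apply, MvPolynomial.comp_aeval]
  rfl

theorem aeval_genericGhost {ι : Type*} (g : ι → B) (f : ℕ → ι) (n : ℕ) :
    MvPolynomial.aeval g (genericGhost π f n) =
      ghostSeq (algebraMap O B π) (residueCard O) (fun i => g (f i)) n := by
  have := map_ghostSeq (MvPolynomial.aeval (R := O) g : MvPolynomial ι O →+* B)
    (algebraMap O _ π) (residueCard O) (fun i => MvPolynomial.X (f i)) n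
  simpa [genericGhost] using this

theorem aeval_ghostSeq {ι : Type*} (g : ι → B) (s : ℕ → MvPolynomial ι O) (n : ℕ) :
    MvPolynomial.aeval g (ghostSeq (algebraMap O _ π) (residueCard O) s n) =
      ghostSeq (algebraMap O B π) (residueCard O) (fun i => MvPolynomial.aeval g (s i)) n := by
  have := map_ghostSeq (MvPolynomial.aeval (R := O) g : MvPolynomial ι O →+* B)
    (algebraMap O _ π) (residueCard O) s n
  simpa using this

theorem ghost_zero (n : ℕ) [Finite (ResidueField O)] :
    ghost (0 : RamifiedWittVector π B) n = 0 := by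
  rw [ghost, ghostSeq]
  refine Finset.sum_eq_zero fun i _ => ?_
  change _ * (0 : B) ^ _ = 0
  rw [zero_pow (pow_ne_zero _ (residueCard_pos O).ne'), mul_zero]

theorem ghost_one (n : ℕ) [Finite (ResidueField O)] :
    ghost (1 : RamifiedWittVector π B) n = 1 := by
  rw [ghost, ghostSeq]
  refine (Finset.sum_eq_single 0 (fun i _ hi => ?_) (by simp)).trans ?_
  · change _ * (if i = 0 then (1 : B) else 0) ^ _ = 0
    rw [if_neg hi, zero_pow (pow_ne_zero _ (residueCard_pos O).ne'), mul_zero]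
  · change _ * (if (0 : ℕ) = 0 then (1 : B) else 0) ^ _ = 1
    rw [if_pos rfl, one_pow, pow_zero, mul_one]

variable [Finite (ResidueField O)] [hπ : Fact (Irreducible π)]

theorem dvd_genericGhost {ι : Type*} (f : ℕ → ι) (n : ℕ) :
    algebraMap O (MvPolynomial ι O) π ^ (n + 1) ∣
      MvPolynomial.expand (residueCard O) (genericGhost π f n) - genericGhost π f (n + 1) := by
  have h := map_ghostSeq ((MvPolynomial.expand (residueCard O) : MvPolynomial ι O →ₐ[O] MvPolynomial ι O) :
      MvPolynomial ι O →+* MvPolynomial ι O)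
    (algebraMap O _ π) (residueCard O) (fun i => MvPolynomial.X (f i)) n
  have h' : MvPolynomial.expand (residueCard O) (genericGhost π f n) =
      ∑ i ∈ Finset.range (n + 1), algebraMap O (MvPolynomial ι O) π ^ i *
        MvPolynomial.X (f i) ^ residueCard O ^ (n + 1 - i) := by
    refine h.trans (Finset.sum_congr rfl fun i hi => ?_)
    have hi' : i ≤ n := Nat.lt_succ_iff.1 (Finset.mem_range.1 hi)
    have e : n + 1 - i = 1 + (n - i) := by omega
    have h2 : ((MvPolynomial.expand (residueCard O) : MvPolynomial ι O →ₐ[O] MvPolynomial ι O) :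
      MvPolynomial ι O →+* MvPolynomial ι O)
      (algebraMap O _ π) = algebraMap O _ π := (MvPolynomial.expand _).commutes π
    rw [h2, e, pow_add, pow_one, pow_mul]
    congr 2
    exact MvPolynomial.expand_X _ _
  rw [h', genericGhost, ghostSeq_eq_add, sub_add_cancel_left]
  exact (dvd_mul_right _ _).neg_right

theorem dvd_sub_mul {P : Type*} [CommRing P] {d a b a' b' : P} (h : d ∣ a - a')
    (h' : d ∣ b - b') : d ∣ a * b - a' * b' := by
  have : a * b - a' * b' = (a - a') * b + a' * (b - b') := by ring
  rw [this]
  exact dvd_add (h.mul_right _) (h'.mul_left _)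

theorem ghost_add (x y : RamifiedWittVector π B) (n : ℕ) :
    ghost (x + y) n = ghost x n + ghost y n := by
  refine (aeval_ghostSeq (Sum.elim x.coeff y.coeff) (addPoly π) n).symm.trans ?_
  rw [addPoly, structurePoly, ghostSeq_ghostLift_mvPolynomial hπ.out, map_add,
    aeval_genericGhost, aeval_genericGhost]
  · rfl
  · intro n
    rw [map_add, add_sub_add_comm]
    exact dvd_add (dvd_genericGhost _ n) (dvd_genericGhost _ n)

theorem ghost_mul (x y : RamifiedWittVector π B) (n : ℕ) :
    ghost (x * y) n = ghost x n * ghost y n := by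
  refine (aeval_ghostSeq (Sum.elim x.coeff y.coeff) (mulPoly π) n).symm.trans ?_
  rw [mulPoly, structurePoly, ghostSeq_ghostLift_mvPolynomial hπ.out, map_mul,
    aeval_genericGhost, aeval_genericGhost]
  · rfl
  · intro n
    rw [map_mul]
    exact dvd_sub_mul (dvd_genericGhost _ n) (dvd_genericGhost _ n)

theorem ghost_neg (x : RamifiedWittVector π B) (n : ℕ) : ghost (-x) n = -ghost x n := by
  refine (aeval_ghostSeq x.coeff (negPoly π) n).symm.trans ?_
  rw [negPoly, structurePoly, ghostSeq_ghostLift_mvPolynomial hπ.out, map_neg,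
    aeval_genericGhost]
  · rfl
  · intro n
    rw [map_neg, ← neg_sub', dvd_neg]
    exact dvd_genericGhost _ n

theorem ghost_injective_mvPolynomial {ι : Type*} {x y : RamifiedWittVector π (MvPolynomial ι O)}
    (h : ∀ n, ghost x n = ghost y n) : x = y :=
  RamifiedWittVector.ext
    (ghostSeq_injective (mvPolynomial_eq_zero_of_mul hπ.out) (residueCard O) (funext h))

theorem ghost_injective_self {x y : RamifiedWittVector π O}
    (h : ∀ n, ghost x n = ghost y n) : x = y :=
  RamifiedWittVector.ext (ghostSeq_injective
    (fun _ hz => (mul_eq_zero.1 hz).resolve_left hπ.out.ne_zero) (residueCard O) (funext h))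

variable (O) in
/-- Every vector over `B` comes from one over a polynomial ring over `O`. -/
theorem exists_lift (x : RamifiedWittVector π B) :
    ∃ y : RamifiedWittVector π (MvPolynomial B O), mapFun (MvPolynomial.aeval (R := O) id) y = x :=
  mapFun_surjective (fun b => ⟨MvPolynomial.X b, by simp⟩) x

/-- The ring structure on `B^ℕ` for which the ghost components are ring homomorphisms,
functorially in the `O`-algebra `B`. -/
noncomputable instance : CommRing (RamifiedWittVector π B) :=
  CommRing.ofMinimalAxioms
    (fun x y z => by
      obtain ⟨x, rfl⟩ := exists_lift O x
      obtain ⟨y, rfl⟩ := exists_lift O y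
      obtain ⟨z, rfl⟩ := exists_lift O z
      simp only [← mapFun_add]
      congr 1
      refine ghost_injective_mvPolynomial fun n => ?_
      simp only [ghost_add, add_assoc])
    (fun x => by
      obtain ⟨x, rfl⟩ := exists_lift O x
      rw [← mapFun_zero (MvPolynomial.aeval (R := O) id), ← mapFun_add]
      congr 1
      refine ghost_injective_mvPolynomial fun n => ?_
      simp only [ghost_add, ghost_zero, zero_add])
    (fun x => by
      obtain ⟨x, rfl⟩ := exists_lift O x
      rw [← mapFun_zero (MvPolynomial.aeval (R := O) id), ← mapFun_neg, ← mapFun_add]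
      congr 1
      refine ghost_injective_mvPolynomial fun n => ?_
      simp only [ghost_add, ghost_neg, ghost_zero, neg_add_cancel])
    (fun x y z => by
      obtain ⟨x, rfl⟩ := exists_lift O x
      obtain ⟨y, rfl⟩ := exists_lift O y
      obtain ⟨z, rfl⟩ := exists_lift O z
      simp only [← mapFun_mul]
      congr 1
      refine ghost_injective_mvPolynomial fun n => ?_
      simp only [ghost_mul, mul_assoc])
    (fun x y => by
      obtain ⟨x, rfl⟩ := exists_lift O x
      obtain ⟨y, rfl⟩ := exists_lift O y
      simp only [← mapFun_mul]
      congr 1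
      refine ghost_injective_mvPolynomial fun n => ?_
      simp only [ghost_mul, mul_comm])
    (fun x => by
      obtain ⟨x, rfl⟩ := exists_lift O x
      rw [← mapFun_one (MvPolynomial.aeval (R := O) id), ← mapFun_mul]
      congr 1
      refine ghost_injective_mvPolynomial fun n => ?_
      simp only [ghost_mul, ghost_one, one_mul])
    (fun x y z => by
      obtain ⟨x, rfl⟩ := exists_lift O x
      obtain ⟨y, rfl⟩ := exists_lift O y
      obtain ⟨z, rfl⟩ := exists_lift O z
      simp only [← mapFun_add, ← mapFun_mul]
      congr 1
      refine ghost_injective_mvPolynomial fun n => ?_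
      simp only [ghost_mul, ghost_add, mul_add])

/-- The homomorphism induced on ramified Witt vectors by a homomorphism of `O`-algebras. -/
noncomputable def map : RamifiedWittVector π B →+* RamifiedWittVector π C where
  toFun := mapFun f
  map_one' := mapFun_one f
  map_mul' := mapFun_mul f
  map_zero' := mapFun_zero f
  map_add' := mapFun_add f

/-- The ghost map `Φ_B : W_O(B) → B^ℕ`. -/
noncomputable def ghostMap : RamifiedWittVector π B →+* (ℕ → B) where
  toFun := ghost
  map_one' := funext fun n => ghost_one n
  map_mul' x y := funext (ghost_mul x y)
  map_zero' := funext fun n => ghost_zero n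
  map_add' x y := funext (ghost_add x y)

theorem ghost_constSeq (c : O) (n : ℕ) :
    ghost (⟨constSeq π c⟩ : RamifiedWittVector π O) n = c :=
  ghostSeq_ghostLift (dvd_residueCard hπ.out) (RingHom.id O) rfl
    (dvd_sub_pow_residueCard hπ.out) (fun n => by simp) n

variable (π B) in
/-- The structure map `O → W_O(O) → W_O(B)`, where `c` maps to the vector in `W_O(O)` all of whose
ghost components are `c`. -/
noncomputable def ofBase : O →+* RamifiedWittVector π B :=
  (map (Algebra.ofId O B)).comp
    { toFun := fun c => ⟨constSeq π c⟩
      map_one' := ghost_injective_self fun n => by rw [ghost_constSeq, ghost_one]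
      map_mul' := fun a b => ghost_injective_self fun n => by
        rw [ghost_mul, ghost_constSeq, ghost_constSeq, ghost_constSeq]
      map_zero' := ghost_injective_self fun n => by rw [ghost_constSeq, ghost_zero]
      map_add' := fun a b => ghost_injective_self fun n => by
        rw [ghost_add, ghost_constSeq, ghost_constSeq, ghost_constSeq] }

/-- The `O`-algebra structure on `W_O(B)`. -/
noncomputable instance : Algebra O (RamifiedWittVector π B) :=
  (ofBase π B).toAlgebra

/-- The ghost map is `O`-linear for the componentwise action of `O` on `B^ℕ`. -/
theorem ghost_algebraMap (c : O) (n : ℕ) :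
    ghost (algebraMap O (RamifiedWittVector π B) c) n = algebraMap O B c := by
  have h := map_ghostSeq (algebraMap O B) π (residueCard O) (constSeq π c) n
  exact h.symm.trans (congrArg (algebraMap O B) (ghost_constSeq c n))

end Operations

/-! ## The Drinfeld map -/

section Drinfeld

variable (p : ℕ) [Fact p.Prime]

/-- The polynomials `u_0, u_1, …` over `O` determined by `Φ_m(u_0, u_1, …) = w_(mh)(X)`, where `w_n`
is the `n`-th Witt polynomial for `p` and `p ^ h` is the cardinality of the residue field. -/
noncomputable def drinfeldPoly : ℕ → MvPolynomial ℕ O :=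
  structurePoly π fun m => wittPolynomial p O (m * residueDegree O p)

variable {B : Type*} [CommRing B] [Algebra O B]

/-- The function underlying the Drinfeld map. -/
noncomputable def drinfeldFun (b : WittVector p B) : RamifiedWittVector π B :=
  ⟨fun n => MvPolynomial.aeval b.coeff (drinfeldPoly π p n)⟩

theorem drinfeldFun_map {C : Type*} [CommRing C] [Algebra O C] (f : B →ₐ[O] C)
    (b : WittVector p B) :
    drinfeldFun π p (WittVector.map (f : B →+* C) b) = mapFun f (drinfeldFun π p b) := by
  ext n
  change MvPolynomial.aeval _ _ = f (MvPolynomial.aeval _ _)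
  rw [← AlgHom.comp_apply, MvPolynomial.comp_aeval]
  rfl

variable [Finite (ResidueField O)] [hπ : Fact (Irreducible π)] [CharP (ResidueField O) p]

theorem dvd_wittPolynomial (m : ℕ) :
    algebraMap O (MvPolynomial ℕ O) π ^ (m + 1) ∣
      MvPolynomial.expand (residueCard O) (wittPolynomial p O (m * residueDegree O p)) -
        wittPolynomial p O ((m + 1) * residueDegree O p) := by
  have hp : algebraMap O (MvPolynomial ℕ O) π ∣ (p : MvPolynomial ℕ O) := by
    rw [← map_natCast (algebraMap O (MvPolynomial ℕ O))]
    exact map_dvd _ (dvd_prime hπ.out p)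
  have hh := residueDegree_pos O p
  have hle : m ≤ m * residueDegree O p := Nat.le_mul_of_pos_right m hh
  have e0 : ∀ n, wittPolynomial p O n = ∑ i ∈ Finset.range (n + 1),
      (p : MvPolynomial ℕ O) ^ i * MvPolynomial.X i ^ p ^ (n - i) := by
    intro n
    rw [wittPolynomial_eq_sum_C_mul_X_pow]
    simp
  have hq := residueCard_eq O p
  generalize residueDegree O p = h at *
  have e1 : MvPolynomial.expand (residueCard O) (wittPolynomial p O (m * h)) =
      ∑ i ∈ Finset.range (m * h + 1),
        (p : MvPolynomial ℕ O) ^ i * MvPolynomial.X i ^ p ^ ((m + 1) * h - i) := by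
    rw [e0, map_sum]
    refine Finset.sum_congr rfl fun i hi => ?_
    have hi' : i ≤ m * h := Nat.lt_succ_iff.1 (Finset.mem_range.1 hi)
    have e : (m + 1) * h - i = h + (m * h - i) := by rw [add_mul, one_mul]; omega
    rw [map_mul, map_pow, map_natCast, map_pow, MvPolynomial.expand_X, ← pow_mul, e, pow_add p h,
      hq]
  have e2 : m * h + 1 ≤ (m + 1) * h + 1 := by rw [add_mul, one_mul]; omega
  rw [e1, e0, ← Finset.sum_range_add_sum_Ico _ e2, sub_add_cancel_left, dvd_neg]
  refine Finset.dvd_sum fun i hi => Dvd.dvd.mul_right ?_ _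
  have hi' : m * h + 1 ≤ i := (Finset.mem_Ico.1 hi).1
  exact (pow_dvd_pow _ (by omega)).trans (pow_dvd_pow_of_dvd hp i)

theorem ghost_drinfeldFun (b : WittVector p B) (m : ℕ) :
    ghost (drinfeldFun π p b) m = WittVector.ghostComponent (m * residueDegree O p) b := by
  refine (aeval_ghostSeq b.coeff (drinfeldPoly π p) m).symm.trans ?_
  rw [drinfeldPoly, structurePoly, ghostSeq_ghostLift_mvPolynomial hπ.out
    (dvd_wittPolynomial π p), aeval_wittPolynomial, WittVector.ghostComponent_apply,
    aeval_wittPolynomial]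

/-- The Drinfeld map `u_B : W(B) → W_O(B)` for an `O`-algebra `B`, with
`Φ_m(u_B(b)) = w_(mh)(b)`. -/
noncomputable def drinfeld : WittVector p B →+* RamifiedWittVector π B :=
  have lift : ∀ x : WittVector p B, ∃ y : WittVector p (MvPolynomial B O),
      WittVector.map (MvPolynomial.aeval (R := O) (id : B → B) : MvPolynomial B O →+* B) y = x :=
    WittVector.map_surjective _ fun b => ⟨MvPolynomial.X b, by simp⟩
  { toFun := drinfeldFun π p
    map_one' := by
      rw [← map_one (WittVector.map
        (MvPolynomial.aeval (R := O) (id : B → B) : MvPolynomial B O →+* B)), drinfeldFun_map,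
        ← mapFun_one (MvPolynomial.aeval (R := O) (id : B → B))]
      congr 1
      refine ghost_injective_mvPolynomial fun n => ?_
      rw [ghost_drinfeldFun, map_one, ghost_one]
    map_mul' := fun x y => by
      obtain ⟨x, rfl⟩ := lift x
      obtain ⟨y, rfl⟩ := lift y
      rw [← map_mul, drinfeldFun_map, drinfeldFun_map, drinfeldFun_map, ← mapFun_mul]
      congr 1
      refine ghost_injective_mvPolynomial fun n => ?_
      rw [ghost_mul, ghost_drinfeldFun, ghost_drinfeldFun, ghost_drinfeldFun, map_mul]
    map_zero' := by
      rw [← map_zero (WittVector.map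
        (MvPolynomial.aeval (R := O) (id : B → B) : MvPolynomial B O →+* B)), drinfeldFun_map,
        ← mapFun_zero (MvPolynomial.aeval (R := O) (id : B → B))]
      congr 1
      refine ghost_injective_mvPolynomial fun n => ?_
      rw [ghost_drinfeldFun, map_zero, ghost_zero]
    map_add' := fun x y => by
      obtain ⟨x, rfl⟩ := lift x
      obtain ⟨y, rfl⟩ := lift y
      rw [← map_add, drinfeldFun_map, drinfeldFun_map, drinfeldFun_map, ← mapFun_add]
      congr 1
      refine ghost_injective_mvPolynomial fun n => ?_
      rw [ghost_add, ghost_drinfeldFun, ghost_drinfeldFun, ghost_drinfeldFun, map_add] }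

end Drinfeld

end RamifiedWittVector

/-! ## The canonical homomorphism `W(k) → O` -/

section Canonical

variable (p : ℕ) [Fact p.Prime] (O : Type*) [CommRing O] [IsDomain O] [IsDiscreteValuationRing O]
  [Finite (ResidueField O)] [CharP (ResidueField O) p]

variable {O} in
theorem dvd_ghostComponent_sub {π : O} (hπ : Irreducible π) (x : WittVector p O) (m j : ℕ) :
    π ^ (m + 1) ∣ WittVector.ghostComponent ((m + j) * residueDegree O p) x -
      WittVector.ghostComponent (m * residueDegree O p) x := by
  have : Fact (Irreducible π) := ⟨hπ⟩
  have step : ∀ m, π ^ (m + 1) ∣ WittVector.ghostComponent ((m + 1) * residueDegree O p) x -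
      WittVector.ghostComponent (m * residueDegree O p) x := by
    intro m
    rw [← RamifiedWittVector.ghost_drinfeldFun π p x,
      ← RamifiedWittVector.ghost_drinfeldFun π p x, RamifiedWittVector.ghost,
      RamifiedWittVector.ghost, ghostSeq_eq_add, Algebra.algebraMap_self, RingHom.id_apply,
      add_sub_right_comm, ghostSeq, ← Finset.sum_sub_distrib]
    refine dvd_add (Finset.dvd_sum fun i hi => ?_) (dvd_mul_right _ _)
    have hi' : i ≤ m := Nat.lt_succ_iff.1 (Finset.mem_range.1 hi)
    have e1 : m + 1 - i = 1 + (m - i) := by omega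
    have e2 : m + 1 = i + (m - i + 1) := by omega
    rw [← mul_sub, e1, pow_add (residueCard O), pow_one, pow_mul, e2, pow_add π i]
    refine mul_dvd_mul_left _ (dvd_pow_sub_pow (dvd_residueCard hπ) ?_ _)
    rw [← dvd_neg, neg_sub]
    exact dvd_sub_pow_residueCard hπ _
  induction j with
  | zero => simp
  | succ j ih =>
    have := dvd_add ((pow_dvd_pow π (by omega)).trans (step (m + j))) ih
    rwa [sub_add_sub_cancel] at this

variable {O} in
theorem dvd_ghostComponent {π : O} (hπ : Irreducible π) (x : WittVector p O)
    (hx : ∀ i, π ∣ x.coeff i) (n : ℕ) : π ^ (n + 1) ∣ WittVector.ghostComponent n x := by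
  rw [WittVector.ghostComponent_apply, aeval_wittPolynomial]
  refine Finset.dvd_sum fun i hi => ?_
  have hi' : i ≤ n := Nat.lt_succ_iff.1 (Finset.mem_range.1 hi)
  have h1 := dvd_pow_sub_pow (dvd_prime hπ p) (a := x.coeff i) (b := 0)
    (by simpa using hx i) (n - i)
  rw [zero_pow (pow_ne_zero _ (Fact.out : p.Prime).ne_zero), sub_zero] at h1
  rw [show n + 1 = i + (n - i + 1) by omega, pow_add]
  exact mul_dvd_mul (pow_dvd_pow_of_dvd (dvd_prime hπ p) i) h1

variable {O} in
theorem mk_maximalIdeal_pow_eq_iff {π : O} (hπ : Irreducible π) (n : ℕ) (x y : O) :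
    Ideal.Quotient.mk (maximalIdeal O ^ n) x = Ideal.Quotient.mk (maximalIdeal O ^ n) y ↔
      π ^ n ∣ x - y := by
  rw [Ideal.Quotient.mk_eq_mk_iff_sub_mem, hπ.maximalIdeal_eq, Ideal.span_singleton_pow,
    Ideal.mem_span_singleton]

/-- The homomorphism `W(k) → O / 𝔪^n` mapping the reduction of `x ∈ W(O)` to `w_(nh)(x)`. -/
noncomputable def wittToBaseMod (n : ℕ) :
    WittVector p (ResidueField O) →+* O ⧸ maximalIdeal O ^ n :=
  RingHom.liftOfSurjective (WittVector.map (residue O))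
    (WittVector.map_surjective _ residue_surjective)
    ⟨(Ideal.Quotient.mk (maximalIdeal O ^ n)).comp
      (WittVector.ghostComponent (n * residueDegree O p)), fun x hx => by
        obtain ⟨π, hπ⟩ := IsDiscreteValuationRing.exists_irreducible O
        rw [RingHom.mem_ker, WittVector.map_eq_zero_iff] at hx
        rw [RingHom.mem_ker, RingHom.comp_apply, ← map_zero (Ideal.Quotient.mk _),
          mk_maximalIdeal_pow_eq_iff hπ, sub_zero]
        have hle := Nat.le_mul_of_pos_right n (residueDegree_pos O p)
        exact (pow_dvd_pow π (by omega)).trans (dvd_ghostComponent p hπ x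
          (fun i => (dvd_iff_residue_eq_zero hπ _).2 (hx i)) _)⟩

theorem wittToBaseMod_map (n : ℕ) (x : WittVector p O) :
    wittToBaseMod p O n (WittVector.map (residue O) x) =
      Ideal.Quotient.mk _ (WittVector.ghostComponent (n * residueDegree O p) x) :=
  RingHom.liftOfSurjective_comp_apply ..

theorem wittToBaseMod_compat {m n : ℕ} (hle : m ≤ n) :
    (Ideal.Quotient.factorPow (maximalIdeal O) hle).comp (wittToBaseMod p O n) =
      wittToBaseMod p O m := by
  obtain ⟨π, hπ⟩ := IsDiscreteValuationRing.exists_irreducible O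
  ext x
  obtain ⟨x, rfl⟩ := WittVector.map_surjective (residue O) residue_surjective x
  rw [RingHom.comp_apply, wittToBaseMod_map, wittToBaseMod_map]
  refine (mk_maximalIdeal_pow_eq_iff hπ m _ _).2 ?_
  obtain ⟨j, rfl⟩ := Nat.exists_eq_add_of_le hle
  exact (pow_dvd_pow π (by omega)).trans (dvd_ghostComponent_sub p hπ x m j)

variable [IsAdicComplete (maximalIdeal O) O]

/-- The canonical homomorphism `W(k) → O`, i.e. the unique one that induces the identity on residue
fields (`residue_wittToBase`, `wittToBase_unique`). -/
noncomputable def wittToBase : WittVector p (ResidueField O) →+* O :=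
  IsAdicComplete.liftRingHom (maximalIdeal O) (wittToBaseMod p O)
    (wittToBaseMod_compat p O)

variable {O} in
theorem dvd_wittToBase_sub {π : O} (hπ : Irreducible π) (x : WittVector p O) (m : ℕ) :
    π ^ (m + 1) ∣ wittToBase p O (WittVector.map (residue O) x) -
      WittVector.ghostComponent (m * residueDegree O p) x := by
  have h1 : Ideal.Quotient.mk (maximalIdeal O ^ (m + 1))
      (wittToBase p O (WittVector.map (residue O) x)) = Ideal.Quotient.mk _
        (WittVector.ghostComponent ((m + 1) * residueDegree O p) x) := by
    rw [← wittToBaseMod_map]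
    exact IsAdicComplete.mk_liftRingHom _ _ (wittToBaseMod_compat p O) _ _
  have := dvd_add ((mk_maximalIdeal_pow_eq_iff hπ _ _ _).1 h1)
    (dvd_ghostComponent_sub p hπ x m 1)
  rwa [sub_add_sub_cancel] at this

theorem residue_wittToBase (x : WittVector p (ResidueField O)) :
    residue O (wittToBase p O x) = x.coeff 0 := by
  obtain ⟨π, hπ⟩ := IsDiscreteValuationRing.exists_irreducible O
  obtain ⟨x, rfl⟩ := WittVector.map_surjective (residue O) residue_surjective x
  have h := dvd_wittToBase_sub p hπ x 0
  rw [zero_add, pow_one, dvd_iff_residue_eq_zero hπ, map_sub, sub_eq_zero] at h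
  rw [h, WittVector.ghostComponent_apply, aeval_wittPolynomial]
  simp

theorem wittToBase_unique (φ : WittVector p (ResidueField O) →+* O)
    (hφ : ∀ x, residue O (φ x) = x.coeff 0) : φ = wittToBase p O := by
  obtain ⟨π, hπ⟩ := IsDiscreteValuationRing.exists_irreducible O
  refine IsAdicComplete.eq_liftRingHom (maximalIdeal O) _ (wittToBaseMod_compat p O) φ fun n => ?_
  have key : (Ideal.Quotient.mk (maximalIdeal O ^ n)).comp φ =
      (Ideal.Quotient.mk (maximalIdeal O ^ n)).comp (wittToBase p O) := by
    refine WittVector.eq_of_apply_teichmuller_eq _ _ ⟨n, ?_⟩ fun a => ?_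
    · rw [← map_natCast (Ideal.Quotient.mk (maximalIdeal O ^ n)), ← map_pow,
        ← map_zero (Ideal.Quotient.mk _), mk_maximalIdeal_pow_eq_iff hπ, sub_zero]
      exact pow_dvd_pow_of_dvd (dvd_prime hπ p) n
    · have : Fintype (ResidueField O) := Fintype.ofFinite _
      have ha : a ^ residueCard O ^ n = a := by
        rw [residueCard, Nat.card_eq_fintype_card, FiniteField.pow_card_pow]
      have ht : WittVector.teichmuller p a ^ residueCard O ^ n = WittVector.teichmuller p a := by
        rw [← map_pow, ha]
      rw [RingHom.comp_apply, RingHom.comp_apply, mk_maximalIdeal_pow_eq_iff hπ, ← ht, map_pow,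
        map_pow]
      refine (pow_dvd_pow π (Nat.le_succ n)).trans (dvd_pow_sub_pow (dvd_residueCard hπ) ?_ n)
      rw [dvd_iff_residue_eq_zero hπ, map_sub, hφ, residue_wittToBase, sub_self]
  rw [key]
  exact IsAdicComplete.mk_comp_liftRingHom _ _ (wittToBaseMod_compat p O) _

end Canonical

/-! ## The map `r_A : W(A) ⊗_{W(k)} O → W_O(A)` -/

/-- For an `R`-algebra `S`, the ring `W(S)` is a `W(R)`-algebra by functoriality. -/
noncomputable instance wittVectorAlgebra (p : ℕ) [Fact p.Prime] (R S : Type*) [CommRing R]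
    [CommRing S] [Algebra R S] : Algebra (WittVector p R) (WittVector p S) :=
  (WittVector.map (algebraMap R S)).toAlgebra

section Comparison

open scoped TensorProduct

variable (p : ℕ) [Fact p.Prime] {O : Type*} [CommRing O] [IsDomain O] [IsDiscreteValuationRing O]
  [Finite (ResidueField O)] [CharP (ResidueField O) p] [IsAdicComplete (maximalIdeal O) O]
  (π : O) [hπ : Fact (Irreducible π)]

/-- `O` as an algebra over the Witt vectors of its residue field. -/
noncomputable instance baseAlgebra : Algebra (WittVector p (ResidueField O)) O :=
  (wittToBase p O).toAlgebra

/-- `W_O(B)` as an algebra over `W(k)`, by restriction of scalars from `O`. -/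
noncomputable instance ramifiedAlgebra (B : Type*) [CommRing B] [Algebra O B] :
    Algebra (WittVector p (ResidueField O)) (RamifiedWittVector π B) :=
  ((algebraMap O (RamifiedWittVector π B)).comp (wittToBase p O)).toAlgebra

instance ramifiedTower (B : Type*) [CommRing B] [Algebra O B] :
    IsScalarTower (WittVector p (ResidueField O)) O (RamifiedWittVector π B) :=
  IsScalarTower.of_algebraMap_eq fun _ => rfl

variable (A : Type*) [CommRing A] [Algebra O A] [Algebra (ResidueField O) A]
  [IsScalarTower O (ResidueField O) A]

theorem drinfeld_algebraMap (x : WittVector p (ResidueField O)) :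
    RamifiedWittVector.drinfeld π p (algebraMap _ (WittVector p A) x) =
      algebraMap _ (RamifiedWittVector π A) x := by
  obtain ⟨x, rfl⟩ := WittVector.map_surjective (residue O) residue_surjective x
  have h1 : algebraMap (WittVector p (ResidueField O)) (WittVector p A)
      (WittVector.map (residue O) x) =
        WittVector.map (Algebra.ofId O A : O →+* A) x := by
    ext n
    exact (IsScalarTower.algebraMap_apply O (ResidueField O) A (x.coeff n)).symm
  rw [h1]
  refine (RamifiedWittVector.drinfeldFun_map π p (Algebra.ofId O A) x).trans ?_
  ext n
  change algebraMap O A ((RamifiedWittVector.drinfeldFun π p x).coeff n) =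
    algebraMap O A (RamifiedWittVector.constSeq π (wittToBase p O _) n)
  rw [IsScalarTower.algebraMap_apply O (ResidueField O) A,
    IsScalarTower.algebraMap_apply O (ResidueField O) A]
  congr 1
  refine sub_eq_zero.1 ((map_sub (residue O) _ _).symm.trans
    ((dvd_iff_residue_eq_zero hπ.out _).1 ?_))
  refine dvd_sub_of_ghostSeq hπ.out.ne_zero (dvd_residueCard hπ.out) (fun m => ?_) n
  have e1 := RamifiedWittVector.ghost_drinfeldFun π p x m
  have e2 := RamifiedWittVector.ghost_constSeq (π := π)
    (wittToBase p O (WittVector.map (residue O) x)) m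
  rw [RamifiedWittVector.ghost, Algebra.algebraMap_self, RingHom.id_apply] at e1 e2
  rw [e1, e2, ← dvd_neg, neg_sub]
  exact dvd_wittToBase_sub p hπ.out x m

/-- The Drinfeld map of a `k`-algebra `A` as a homomorphism of `W(k)`-algebras. -/
noncomputable def drinfeldAlgHom :
    WittVector p A →ₐ[WittVector p (ResidueField O)] RamifiedWittVector π A :=
  { RamifiedWittVector.drinfeld π p with commutes' := drinfeld_algebraMap p π A }

/-- The homomorphism `r_A : W(A) ⊗_{W(k)} O → W_O(A)`, `x ⊗ c ↦ c • u_A(x)`, extending the Drinfeld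
map of a `k`-algebra `A`. -/
noncomputable def greenbergToRamified :
    WittVector p A ⊗[WittVector p (ResidueField O)] O →ₐ[WittVector p (ResidueField O)]
      RamifiedWittVector π A :=
  Algebra.TensorProduct.productMap (drinfeldAlgHom p π A)
    (IsScalarTower.toAlgHom (WittVector p (ResidueField O)) O (RamifiedWittVector π A))

theorem greenbergToRamified_tmul (x : WittVector p A) (c : O) :
    greenbergToRamified p π A (x ⊗ₜ c) = c • RamifiedWittVector.drinfeld π p x := by
  rw [Algebra.smul_def, mul_comm]
  rfl

end Comparison

/-- A ring of characteristic `p` is semiperfect if its Frobenius is surjective. -/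
def IsSemiperfect (p : ℕ) (A : Type*) [CommRing A] : Prop :=
  Function.Surjective fun a : A => a ^ p

/-- A ring of characteristic `p` is perfect if its Frobenius is bijective. -/
def IsPerfect (p : ℕ) (A : Type*) [CommRing A] : Prop :=
  Function.Bijective fun a : A => a ^ p

/-! ## Expansions in powers of a uniformizer -/

section Expansion

variable {S R : Type*} [CommRing S] [CommRing R] (u : S →+* R) {s : S} {ϖ : R} {e : ℕ}

/-! Write `p` as a unit times `π ^ e`. Over `W(k)`, the ring `O` is generated by `1, π, …, π ^ (e -
1)`, so every element of `W(A) ⊗ O` is a sum of terms `x_j ⊗ π ^ j` with `j < e`, and `r_A` sends it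
to the sum of the `π ^ j * u(x_j)`. Hence surjectivity of `r_A` is the existence of such expansions
in `W_O(A)`, and injectivity follows from their uniqueness; that the powers of `π` form a basis of
`O` is never needed.

Both questions are settled modulo the uniformizers. Since `π` vanishes in `A`, multiplication by `π`
on `W_O(A)` is `(b_0, b_1, …) ↦ (0, b_0^q, b_1^q, …)` (`algebraMap_mul_eq_shiftPow`). So `W_O(A)` is
`π`-adically separated, `π` is regular if `A` is reduced, and `W_O(A) / π = A` if `A` is
semiperfect. Likewise `p = VF` on `W(A)`, so for semiperfect `A` one has `W(A) / p = A`, and Cauchy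
sequences for the `p`-adic topology converge. As `u` preserves the zeroth coefficient, it induces
the identity of `A` on these quotients. Successive approximation then gives existence for
semiperfect `A` (`exists_eq_sum_pow_mul`), and comparison of lowest powers of `π` gives uniqueness
for perfect `A` (`eq_zero_of_sum_pow_mul_eq_zero`). A reduced `A` embeds in its perfect closure, and
uniqueness descends by functoriality.

The same two expansion lemmas, with `e = 1` and `O → W_O(k)` in place of `u`, give the last
assertion. -/

theorem dvd_of_sum_pow_mul_eq_zero (hϖ : IsLeftRegular ϖ) (hs : ϖ ^ e ∣ u s)
    (hu : ∀ x, ϖ ∣ u x → s ∣ x) {x : ℕ → S}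
    (hx : ∑ j ∈ Finset.range e, ϖ ^ j * u (x j) = 0) (j : ℕ) (hj : j < e) : s ∣ x j := by
  induction j using Nat.strong_induction_on with
  | _ j ih =>
    -- Terms with `i < j` are divisible even by `ϖ ^ e`, because `s ∣ x i` by induction; terms with
    -- `i > j` carry the power themselves. Cancelling `ϖ ^ j` from the remaining term leaves `ϖ ∣ u
    -- (x j)`.
    have h1 : ϖ ^ (j + 1) ∣ ∑ i ∈ (Finset.range e).erase j, ϖ ^ i * u (x i) := by
      refine Finset.dvd_sum fun i hi => ?_
      rw [Finset.mem_erase, Finset.mem_range] at hi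
      rcases lt_or_gt_of_ne hi.1 with h | h
      · exact ((pow_dvd_pow ϖ hj).trans (hs.trans (map_dvd u (ih i h hi.2)))).mul_left _
      · exact (pow_dvd_pow ϖ h).mul_right _
    rw [← Finset.add_sum_erase _ _ (Finset.mem_range.2 hj)] at hx
    have h2 : ϖ ^ (j + 1) ∣ ϖ ^ j * u (x j) := by
      rw [eq_neg_of_add_eq_zero_left hx]
      exact h1.neg_right
    obtain ⟨c, hc⟩ := h2
    refine hu _ ⟨c, hϖ.pow j ?_⟩
    simpa only [pow_succ, mul_assoc] using hc

/-- Uniqueness of expansions `∑ ϖ^j u(x_j)`, `j < e`, where `u(s)` is a multiple of `ϖ^e` and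
`S / s → R / ϖ` is injective. -/
theorem eq_zero_of_sum_pow_mul_eq_zero (hϖ : IsLeftRegular ϖ) (hs : ϖ ^ e ∣ u s)
    (hs' : IsLeftRegular (u s)) (hS : ∀ x : S, (∀ n, s ^ n ∣ x) → x = 0)
    (hu : ∀ x, ϖ ∣ u x → s ∣ x) {x : ℕ → S}
    (hx : ∑ j ∈ Finset.range e, ϖ ^ j * u (x j) = 0) (j : ℕ) (hj : j < e) : x j = 0 := by
  refine hS _ fun n => ?_
  -- Descent: all `x j` with `j < e` are multiples `s * y j`, and since `u s` is regular the `y j`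
  -- satisfy the same relation, to which the induction hypothesis applies.
  induction n generalizing x with
  | zero => simp
  | succ n ih =>
    have h := dvd_of_sum_pow_mul_eq_zero u hϖ hs hu hx
    choose! y hy using h
    have hy' : ∑ j ∈ Finset.range e, ϖ ^ j * u (y j) = 0 := by
      refine hs' ?_
      dsimp only
      rw [mul_zero, ← hx, Finset.mul_sum]
      refine Finset.sum_congr rfl fun i hi => ?_
      rw [hy i (Finset.mem_range.1 hi), map_mul]
      ring
    rw [hy j hj, pow_succ']
    exact mul_dvd_mul_left _ (ih hy')

/-- Digits are extracted one at a time: approximate `y` modulo `ϖ`, divide the remainder by `ϖ`, and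
repeat. -/
theorem exists_dvd_sub_sum_pow_mul (hu : ∀ y, ∃ x, ϖ ∣ y - u x) (n : ℕ) (y : R) :
    ∃ x : ℕ → S, ϖ ^ n ∣ y - ∑ j ∈ Finset.range n, ϖ ^ j * u (x j) := by
  induction n generalizing y with
  | zero => exact ⟨0, by simp⟩
  | succ n ih =>
    obtain ⟨a, z, hz⟩ := hu y
    obtain ⟨x, hx⟩ := ih z
    refine ⟨fun j => j.casesOn a x, ?_⟩
    have : y - ∑ j ∈ Finset.range (n + 1), ϖ ^ j * u (j.casesOn a x) =
        ϖ * (z - ∑ j ∈ Finset.range n, ϖ ^ j * u (x j)) := by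
      rw [Finset.sum_range_succ', mul_sub, ← hz, Finset.mul_sum]
      simp only [pow_succ', pow_zero, one_mul, mul_assoc]
      exact sub_add_eq_sub_sub_swap _ _ _
    rw [this, pow_succ']
    exact mul_dvd_mul_left _ hx

/-- Existence of expansions `∑ ϖ^j u(x_j)`, `j < e`, where `S` is `s`-adically complete, `ϖ^e` is a
multiple of `u(s)` and `S → R / ϖ` is surjective. -/
theorem exists_eq_sum_pow_mul (hS : IsPrecomplete (Ideal.span {s}) S) (hs : u s ∣ ϖ ^ e)
    (hs' : ϖ ∣ u s) (hR : ∀ y : R, (∀ n, ϖ ^ n ∣ y) → y = 0) (hu : ∀ y, ∃ x, ϖ ∣ y - u x) (y : R) :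
    ∃ x : ℕ → S, y = ∑ j ∈ Finset.range e, ϖ ^ j * u (x j) := by
  -- After `e` digits the remainder is a multiple of `ϖ ^ e`, hence of `u s`; the next round then
  -- works on the cofactor `z`.
  have step : ∀ y, ∃ x : ℕ → S, ∃ z, y = ∑ j ∈ Finset.range e, ϖ ^ j * u (x j) + u s * z := by
    intro y
    obtain ⟨x, hx⟩ := exists_dvd_sub_sum_pow_mul u hu e y
    obtain ⟨z, hz⟩ := hs.trans hx
    exact ⟨x, z, by rw [← hz]; ring⟩
  choose x z hxz using step
  -- `z^[i] y` is the remainder after `i` rounds, and `t n j` is the `j`-th coefficient collected in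
  -- the first `n` rounds, a partial sum of an `s`-adic series.
  let t : ℕ → ℕ → S := fun n j => ∑ i ∈ Finset.range n, s ^ i * x (z^[i] y) j
  have ht : ∀ n, y = ∑ j ∈ Finset.range e, ϖ ^ j * u (t n j) + u s ^ n * z^[n] y := by
    intro n
    induction n with
    | zero => simp [t]
    | succ n ih =>
      refine ih.trans ?_
      conv_lhs => rw [hxz (z^[n] y), mul_add, Finset.mul_sum, ← add_assoc,
        ← Finset.sum_add_distrib]
      rw [Function.iterate_succ_apply', pow_succ, mul_assoc]
      congr 1
      refine Finset.sum_congr rfl fun j _ => ?_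
      simp only [t, Finset.sum_range_succ, map_add, map_mul, map_pow]
      ring
  have hlim : ∀ j, ∃ L : S, ∀ n, s ^ n ∣ t n j - L := by
    intro j
    obtain ⟨L, hL⟩ := hS.prec (f := fun n => t n j) fun {m n} hmn => by
      rw [smul_eq_mul, Ideal.mul_top, SModEq.sub_mem, Ideal.span_singleton_pow,
        Ideal.mem_span_singleton, ← dvd_neg, neg_sub]
      simp only [t]
      rw [← Finset.sum_range_add_sum_Ico _ hmn, add_sub_cancel_left]
      exact Finset.dvd_sum fun i hi => (pow_dvd_pow s (Finset.mem_Ico.1 hi).1).mul_right _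
    refine ⟨L, fun n => ?_⟩
    have := hL n
    rwa [smul_eq_mul, Ideal.mul_top, SModEq.sub_mem, Ideal.span_singleton_pow,
      Ideal.mem_span_singleton] at this
  choose L hL using hlim
  -- The error is divisible by every `u s ^ n`, hence by every `ϖ ^ n`. Thus `R` only has to be
  -- separated: the limits are taken in `S`.
  refine ⟨L, sub_eq_zero.1 (hR _ fun n => (pow_dvd_pow_of_dvd hs' n).trans ?_)⟩
  rw [show y - ∑ j ∈ Finset.range e, ϖ ^ j * u (L j) =
      ∑ j ∈ Finset.range e, ϖ ^ j * u (t n j - L j) + u s ^ n * z^[n] y by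
    nth_rw 1 [ht n]
    simp only [map_sub, mul_sub, Finset.sum_sub_distrib]
    ring]
  refine dvd_add (Finset.dvd_sum fun j _ => ?_) (dvd_mul_right _ _)
  rw [← map_pow]
  exact (map_dvd u (hL j n)).mul_left _

end Expansion

/-! ## Witt vectors over semiperfect rings -/

namespace WittVector

variable {p : ℕ} [Fact p.Prime] {A : Type*} [CommRing A] [CharP A p]

theorem frobenius_surjective_of_isSemiperfect (hA : IsSemiperfect p A) :
    Function.Surjective (frobenius : WittVector p A → WittVector p A) := by
  rw [frobenius_eq_map_frobenius]
  exact map_surjective _ hA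

/-- In characteristic `p` one has `p = VF`, and `F` is surjective over a semiperfect ring, so `p ^ n
W(A) = V ^ n W(A)`: the `p`-adic filtration is the one by vanishing coefficients. -/
theorem pow_dvd_iff_of_isSemiperfect (hA : IsSemiperfect p A) (x : WittVector p A) (n : ℕ) :
    (p : WittVector p A) ^ n ∣ x ↔ ∀ i < n, x.coeff i = 0 := by
  constructor
  · rintro ⟨y, rfl⟩ i hi
    rw [mul_comm, mul_pow_charP_coeff_zero _ hi]
  · intro h
    obtain ⟨y, hy⟩ := (frobenius_surjective_of_isSemiperfect hA).iterate n (x.shift n)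
    refine ⟨y, ?_⟩
    rw [mul_comm, ← iterate_verschiebung_iterate_frobenius, hy]
    exact eq_iterate_verschiebung h

theorem isPrecomplete_of_isSemiperfect (hA : IsSemiperfect p A) :
    IsPrecomplete (Ideal.span {(p : WittVector p A)}) (WittVector p A) where
  prec' x h := by
    -- Congruence modulo `p ^ (n + 1)` is what fixes the coefficient of index `n`, so it is stable
    -- from the term `x (n + 1)` on.
    refine ⟨.mk p fun n => (x (n + 1)).coeff n, fun n => ?_⟩
    simp only [Ideal.span_singleton_pow, smul_eq_mul, Ideal.mul_top, SModEq.sub_mem,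
      Ideal.mem_span_singleton, pow_dvd_iff_of_isSemiperfect hA,
      ← le_coeff_eq_iff_le_sub_coeff_eq_zero] at h ⊢
    exact fun i hi => (h hi i (Nat.lt_succ_self i)).symm

theorem eq_zero_of_forall_pow_dvd (x : WittVector p A)
    (h : ∀ n, (p : WittVector p A) ^ n ∣ x) : x = 0 := by
  ext n
  obtain ⟨y, rfl⟩ := h (n + 1)
  rw [mul_comm, mul_pow_charP_coeff_zero _ (Nat.lt_succ_self n), zero_coeff]

end WittVector

/-! ## Ramified Witt vectors over algebras over the residue field -/

namespace RamifiedWittVector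

variable {O : Type*} [CommRing O] [IsDomain O] [IsDiscreteValuationRing O]
  [Finite (ResidueField O)] {π : O} [hπ : Fact (Irreducible π)]

/-! ### Functoriality and the zeroth coefficient -/

section Map

variable {B C : Type*} [CommRing B] [Algebra O B] [CommRing C] [Algebra O C]

theorem map_algebraMap (f : B →ₐ[O] C) (c : O) :
    map f (algebraMap O (RamifiedWittVector π B) c) = algebraMap O (RamifiedWittVector π C) c := by
  ext n
  exact f.commutes (constSeq π c n)

/-- The zeroth coefficient as a ring homomorphism. -/
noncomputable def coeffZero : RamifiedWittVector π B →+* B :=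
  (Pi.evalRingHom (fun _ => B) 0).comp ghostMap

theorem coeffZero_apply (x : RamifiedWittVector π B) : coeffZero x = x.coeff 0 := by
  change ghostSeq _ _ _ 0 = _
  simp [ghostSeq]

theorem coeffZero_algebraMap (c : O) :
    coeffZero (algebraMap O (RamifiedWittVector π B) c) = algebraMap O B c :=
  ghost_algebraMap c 0

theorem coeffZero_drinfeld (p : ℕ) [Fact p.Prime] [CharP (ResidueField O) p]
    (x : WittVector p B) : coeffZero (drinfeld π p x) = x.coeff 0 := by
  refine (ghost_drinfeldFun π p x 0).trans ?_
  rw [WittVector.ghostComponent_apply, aeval_wittPolynomial]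
  simp

end Map

/-! ### Multiplication by the uniformizer -/

section Residue

variable {A : Type*} [CommRing A] [Algebra O A]

/-- The vector `(0, b_0^q, b_1^q, …)`. -/
noncomputable def shiftPow {B : Type*} [CommRing B] (x : RamifiedWittVector π B) :
    RamifiedWittVector π B :=
  ⟨fun n => n.casesOn 0 fun m => x.coeff m ^ residueCard O⟩

/-- In `π * Φ_n(x)` every term but the last is a term of `Φ_n` of the shifted vector. The
discrepancy is a multiple of `π ^ (n + 1)`, the precision that `dvd_sub_of_ghostSeq` requires. -/
theorem ghost_shiftPow_add {B : Type*} [CommRing B] [Algebra O B] (x : RamifiedWittVector π B)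
    (n : ℕ) : ghost (shiftPow x) n + algebraMap O B π ^ (n + 1) * x.coeff n =
      algebraMap O B π * ghost x n := by
  rw [ghost, ghost, ghostSeq_eq_add _ _ x.coeff, ghostSeq, Finset.sum_range_succ', mul_add,
    Finset.mul_sum, ← mul_assoc, ← pow_succ']
  congr 1
  have h0 : (shiftPow x).coeff 0 = 0 := rfl
  rw [h0, zero_pow (pow_ne_zero _ (residueCard_pos O).ne'), mul_zero, add_zero]
  refine Finset.sum_congr rfl fun i hi => ?_
  have hi' := Finset.mem_range.1 hi
  change _ * (x.coeff i ^ residueCard O) ^ _ = _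
  rw [← pow_mul, ← pow_succ', pow_succ', mul_assoc, show n - (i + 1) + 1 = n - i by omega]

/-- Ghost components carry too little information over `A`, so `x` is lifted to a polynomial ring
over `O`. There the two sides have ghost components congruent modulo `π ^ (n + 1)`, hence
coefficients congruent modulo `π`, and `π` maps to zero in `A`. -/
theorem algebraMap_mul_eq_shiftPow (hA : algebraMap O A π = 0) (x : RamifiedWittVector π A) :
    algebraMap O _ π * x = shiftPow x := by
  obtain ⟨x, rfl⟩ := exists_lift O x
  ext n
  have h : algebraMap O (MvPolynomial A O) π ∣
      (algebraMap O (RamifiedWittVector π (MvPolynomial A O)) π * x).coeff n -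
        (shiftPow x).coeff n := by
    refine dvd_sub_of_ghostSeq (q := residueCard O) (fun h0 => hπ.out.ne_zero ?_) ?_ ?_ n
    · exact MvPolynomial.C_injective A O (by simpa using h0)
    · rw [← map_natCast (algebraMap O (MvPolynomial A O))]
      exact map_dvd _ (dvd_residueCard hπ.out)
    · intro m
      change _ ∣ ghost _ m - ghost _ m
      rw [ghost_mul, ghost_algebraMap, ← ghost_shiftPow_add, add_sub_cancel_left]
      exact dvd_mul_right _ _
  have h' := map_dvd (MvPolynomial.aeval (R := O) (id : A → A)) h
  rw [AlgHom.commutes, hA, zero_dvd_iff, map_sub, sub_eq_zero] at h'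
  change (algebraMap O _ π * map (MvPolynomial.aeval (R := O) id) x).coeff n = _
  rw [← map_algebraMap (MvPolynomial.aeval (R := O) (id : A → A)), ← map_mul]
  refine h'.trans ?_
  cases n with
  | zero => exact map_zero _
  | succ n => exact map_pow _ _ _

theorem coeff_pow_algebraMap_mul (hA : algebraMap O A π = 0) (x : RamifiedWittVector π A)
    {n i : ℕ} (hi : i < n) : (algebraMap O _ π ^ n * x).coeff i = 0 := by
  induction n generalizing i with
  | zero => omega
  | succ n ih =>
    rw [pow_succ', mul_assoc, algebraMap_mul_eq_shiftPow hA]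
    cases i with
    | zero => rfl
    | succ i =>
      change _ ^ residueCard O = 0
      rw [ih (by omega), zero_pow (residueCard_pos O).ne']

theorem eq_zero_of_forall_pow_dvd (hA : algebraMap O A π = 0) (x : RamifiedWittVector π A)
    (h : ∀ n, algebraMap O (RamifiedWittVector π A) π ^ n ∣ x) : x = 0 := by
  ext n
  obtain ⟨y, rfl⟩ := h (n + 1)
  exact coeff_pow_algebraMap_mul hA y (Nat.lt_succ_self n)

theorem isLeftRegular_algebraMap [IsReduced A] (hA : algebraMap O A π = 0) :
    IsLeftRegular (algebraMap O (RamifiedWittVector π A) π) := by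
  refine isLeftRegular_iff_right_eq_zero_of_mul.2 fun x hx => ?_
  rw [algebraMap_mul_eq_shiftPow hA] at hx
  ext n
  have : x.coeff n ^ residueCard O = 0 := congrArg (fun z => z.coeff (n + 1)) hx
  exact eq_zero_of_pow_eq_zero this

/-- A vector with zeroth coefficient `0` is `π` times the vector of `q`-th roots of its other
coefficients. This identifies `W_O(A) / π` with `A`. -/
theorem algebraMap_dvd_iff (hA : algebraMap O A π = 0)
    (hA' : Function.Surjective fun a : A => a ^ residueCard O) (x : RamifiedWittVector π A) :
    algebraMap O _ π ∣ x ↔ coeffZero x = 0 := by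
  constructor
  · rintro ⟨y, rfl⟩
    rw [map_mul, coeffZero_algebraMap, hA, zero_mul]
  · intro h
    rw [coeffZero_apply] at h
    choose g hg using hA'
    refine ⟨⟨fun n => g (x.coeff (n + 1))⟩, ?_⟩
    rw [algebraMap_mul_eq_shiftPow hA]
    ext n
    cases n with
    | zero => exact h
    | succ n => exact (hg _).symm

end Residue

end RamifiedWittVector

/-! ## Injectivity and surjectivity of the comparison map -/

theorem IsSemiperfect.pow_surjective {p : ℕ} {A : Type*} [CommRing A] (hA : IsSemiperfect p A)
    (n : ℕ) : Function.Surjective fun a : A => a ^ p ^ n := by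
  have := Function.Surjective.iterate hA n
  rwa [pow_iterate] at this

theorem IsPerfect.isReduced {p : ℕ} (hp : p.Prime) {A : Type*} [CommRing A]
    (hA : IsPerfect p A) : IsReduced A where
  eq_zero := by
    rintro x ⟨n, hn⟩
    have := Function.Injective.iterate hA.1 n
    rw [pow_iterate] at this
    refine this ?_
    dsimp only
    rw [zero_pow (pow_ne_zero _ hp.ne_zero),
      pow_eq_zero_of_le (Nat.lt_pow_self hp.one_lt).le hn]

theorem isSemiperfect_of_finite_field (p : ℕ) [Fact p.Prime] (k : Type*) [Field k] [Finite k]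
    [CharP k p] : IsSemiperfect p k :=
  Finite.surjective_of_injective (frobenius k p).injective

theorem PerfectClosure.of_injective (A : Type*) [CommRing A] [IsReduced A] (p : ℕ)
    [Fact p.Prime] [CharP A p] : Function.Injective (PerfectClosure.of A p) := by
  intro x y h
  simpa using (PerfectClosure.eq_iff A p (0, x) (0, y)).1 h

section Comparison

open scoped TensorProduct

variable (p : ℕ) [Fact p.Prime] {O : Type*} [CommRing O] [IsDomain O] [IsDiscreteValuationRing O]
  [Finite (ResidueField O)] [CharP (ResidueField O) p]

theorem exists_associated_pow [CharZero O] {π : O} (hπ : Irreducible π) :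
    ∃ e : ℕ, Associated (p : O) (π ^ e) :=
  IsDiscreteValuationRing.associated_pow_irreducible
    (Nat.cast_ne_zero.2 (Fact.out : p.Prime).ne_zero) hπ

variable {p} in
theorem IsSemiperfect.pow_residueCard_surjective {A : Type*} [CommRing A]
    (hA : IsSemiperfect p A) :
    Function.Surjective fun a : A => a ^ residueCard O := by
  rw [residueCard_eq O p]
  exact hA.pow_surjective _

/-! ### Uniqueness of expansions in `W_O(A)` -/

section Algebra

variable (A : Type*) [CommRing A] [Algebra O A] [Algebra (ResidueField O) A]
  [IsScalarTower O (ResidueField O) A]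

theorem algebraMap_uniformizer_eq_zero {π : O} (hπ : Irreducible π) : algebraMap O A π = 0 := by
  rw [IsScalarTower.algebraMap_apply O (ResidueField O) A, ResidueField.algebraMap_eq,
    (dvd_iff_residue_eq_zero hπ π).1 dvd_rfl, map_zero]

variable (π : O) [hπ : Fact (Irreducible π)]

theorem associated_drinfeld_natCast {e : ℕ} (he : Associated (p : O) (π ^ e)) :
    Associated (RamifiedWittVector.drinfeld π p (p : WittVector p A))
      (algebraMap O (RamifiedWittVector π A) π ^ e) := by
  have := he.map (algebraMap O (RamifiedWittVector π A))
  rwa [map_natCast, map_pow, ← map_natCast (RamifiedWittVector.drinfeld π p)] at this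

variable {p π A} in
/-- Uniqueness of expansions over a perfect `k`-algebra. -/
theorem eq_zero_of_sum_pow_mul_drinfeld_of_perfectRing [CharP A p] [PerfectRing A p] {e : ℕ}
    (he : Associated (p : O) (π ^ e)) {x : ℕ → WittVector p A}
    (hx : ∑ j ∈ Finset.range e, algebraMap O (RamifiedWittVector π A) π ^ j *
        RamifiedWittVector.drinfeld π p (x j) = 0) (j : ℕ) (hj : j < e) : x j = 0 := by
  have hA0 := algebraMap_uniformizer_eq_zero A hπ.out
  have : IsReduced A :=
    IsPerfect.isReduced (Fact.out : p.Prime) (PerfectRing.bijective_frobenius (R := A) (p := p))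
  have hreg := RamifiedWittVector.isLeftRegular_algebraMap (π := π) hA0
  have hA : IsSemiperfect p A := (PerfectRing.bijective_frobenius (R := A) (p := p)).2
  refine eq_zero_of_sum_pow_mul_eq_zero _ (s := (p : WittVector p A)) hreg
    (associated_drinfeld_natCast p A π he).symm.dvd ?_
    WittVector.eq_zero_of_forall_pow_dvd (fun y hy => ?_) hx j hj
  -- `u(p)` is a unit times `π ^ e`, so it inherits regularity from `π`.
  · obtain ⟨v, hv⟩ := (associated_drinfeld_natCast p A π he).symm
    rw [← hv]
    exact (hreg.pow e).mul v.isUnit.isRegular.left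
  -- `π ∣ u(y)` forces the zeroth coefficient of `u(y)`, which is that of `y`, to vanish; over a
  -- perfect ring this means `p ∣ y`.
  · rw [← Ideal.mem_span_singleton, WittVector.mem_span_p_iff_coeff_zero_eq_zero,
      ← RamifiedWittVector.coeffZero_drinfeld (π := π)]
    exact (RamifiedWittVector.algebraMap_dvd_iff hA0 hA.pow_residueCard_surjective _).1 hy

variable {p π A} in
/-- Uniqueness of expansions over a reduced `k`-algebra. -/
theorem eq_zero_of_sum_pow_mul_drinfeld [CharP A p] [IsReduced A] {e : ℕ}
    (he : Associated (p : O) (π ^ e)) {x : ℕ → WittVector p A}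
    (hx : ∑ j ∈ Finset.range e, algebraMap O (RamifiedWittVector π A) π ^ j *
        RamifiedWittVector.drinfeld π p (x j) = 0) (j : ℕ) (hj : j < e) : x j = 0 := by
  let i := PerfectClosure.of A p
  -- The algebra structures are transported along `A → PerfectClosure A p`, so that this map is
  -- `O`-linear and induces a map on ramified Witt vectors.
  let : Algebra O (PerfectClosure A p) := (i.comp (algebraMap O A)).toAlgebra
  let : Algebra (ResidueField O) (PerfectClosure A p) :=
    (i.comp (algebraMap (ResidueField O) A)).toAlgebra
  have : IsScalarTower O (ResidueField O) (PerfectClosure A p) :=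
    IsScalarTower.of_algebraMap_eq fun c =>
      congrArg i (IsScalarTower.algebraMap_apply O (ResidueField O) A c)
  let f : A →ₐ[O] PerfectClosure A p := { i with commutes' := fun _ => rfl }
  have hf := PerfectClosure.of_injective A p
  refine WittVector.map_injective i hf ?_
  rw [map_zero]
  refine eq_zero_of_sum_pow_mul_drinfeld_of_perfectRing (π := π) he
    (x := fun j => WittVector.map i (x j)) ?_ j hj
  have h := congrArg (RamifiedWittVector.map f) hx
  rw [map_zero, map_sum] at h
  rw [← h]
  refine Finset.sum_congr rfl fun j _ => ?_
  rw [map_mul, map_pow, RamifiedWittVector.map_algebraMap]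
  congr 1
  exact RamifiedWittVector.drinfeldFun_map π p f (x j)

end Algebra

variable [IsAdicComplete (maximalIdeal O) O]

/-- The expansion lemma applies to `W(k) → O`: `k` is perfect, `O` is separated, and Teichmüller
representatives lift residue classes. -/
theorem exists_eq_sum_pow_mul_wittToBase {π : O} (hπ : Irreducible π) {e : ℕ}
    (he : Associated (p : O) (π ^ e)) (c : O) :
    ∃ x : ℕ → WittVector p (ResidueField O),
      c = ∑ j ∈ Finset.range e, π ^ j * wittToBase p O (x j) := by
  refine exists_eq_sum_pow_mul (wittToBase p O) (s := p)
    (WittVector.isPrecomplete_of_isSemiperfect (isSemiperfect_of_finite_field p _)) ?_ ?_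
    (fun y hy => ?_) (fun y => ⟨WittVector.teichmuller p (residue O y), ?_⟩) c
  · rw [map_natCast]
    exact he.dvd
  · rw [map_natCast]
    exact dvd_prime hπ p
  · refine IsHausdorff.haus (I := maximalIdeal O) inferInstance y fun n => ?_
    rw [SModEq.zero, smul_eq_mul, Ideal.mul_top, hπ.maximalIdeal_eq, Ideal.span_singleton_pow,
      Ideal.mem_span_singleton]
    exact hy n
  · rw [dvd_iff_residue_eq_zero hπ, map_sub, residue_wittToBase, WittVector.teichmuller_coeff_zero,
      sub_self]

variable (π : O) [hπ : Fact (Irreducible π)]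
variable (A : Type*) [CommRing A] [Algebra O A] [Algebra (ResidueField O) A]
  [IsScalarTower O (ResidueField O) A]

variable {p π A} in
theorem exists_eq_sum_tmul_pow {e : ℕ} (he : Associated (p : O) (π ^ e))
    (t : WittVector p A ⊗[WittVector p (ResidueField O)] O) :
    ∃ x : ℕ → WittVector p A, t = ∑ j ∈ Finset.range e, x j ⊗ₜ (π ^ j) := by
  induction t with
  | zero => exact ⟨0, by simp⟩
  | tmul x c =>
    obtain ⟨y, rfl⟩ := exists_eq_sum_pow_mul_wittToBase p hπ.out he c
    refine ⟨fun j => y j • x, ?_⟩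
    rw [TensorProduct.tmul_sum]
    refine Finset.sum_congr rfl fun j _ => ?_
    rw [TensorProduct.smul_tmul, Algebra.smul_def, mul_comm]
    rfl
  | add s t hs ht =>
    obtain ⟨x, rfl⟩ := hs
    obtain ⟨y, rfl⟩ := ht
    exact ⟨x + y, by simp [TensorProduct.add_tmul, Finset.sum_add_distrib]⟩

theorem greenbergToRamified_sum_tmul_pow (e : ℕ) (x : ℕ → WittVector p A) :
    greenbergToRamified p π A (∑ j ∈ Finset.range e, x j ⊗ₜ (π ^ j)) =
      ∑ j ∈ Finset.range e, algebraMap O (RamifiedWittVector π A) π ^ j *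
        RamifiedWittVector.drinfeld π p (x j) := by
  rw [map_sum]
  refine Finset.sum_congr rfl fun j _ => ?_
  rw [greenbergToRamified_tmul, Algebra.smul_def, map_pow]

theorem greenbergToRamified_surjective [CharZero O] (hA : IsSemiperfect p A) :
    Function.Surjective (greenbergToRamified p π A) := by
  -- The zero ring does not have characteristic `p` and is treated apart; a nonzero `A` inherits the
  -- characteristic of `k`.
  rcases subsingleton_or_nontrivial A with h | h
  · exact fun y => ⟨0, RamifiedWittVector.ext (Subsingleton.elim _ _)⟩
  have : CharP A p := charP_of_injective_algebraMap (algebraMap (ResidueField O) A).injective p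
  have hA0 := algebraMap_uniformizer_eq_zero A hπ.out
  obtain ⟨e, he⟩ := exists_associated_pow p hπ.out
  intro y
  obtain ⟨x, rfl⟩ := exists_eq_sum_pow_mul (RamifiedWittVector.drinfeld π p)
    (WittVector.isPrecomplete_of_isSemiperfect hA) (associated_drinfeld_natCast p A π he).dvd
    (by
      rw [map_natCast, ← map_natCast (algebraMap O (RamifiedWittVector π A))]
      exact map_dvd _ (dvd_prime hπ.out p))
    (RamifiedWittVector.eq_zero_of_forall_pow_dvd hA0)
    (fun y => ⟨WittVector.teichmuller p (RamifiedWittVector.coeffZero y), by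
      rw [RamifiedWittVector.algebraMap_dvd_iff hA0 hA.pow_residueCard_surjective, map_sub,
        RamifiedWittVector.coeffZero_drinfeld, WittVector.teichmuller_coeff_zero, sub_self]⟩) y
  exact ⟨_, greenbergToRamified_sum_tmul_pow p π A e x⟩

theorem greenbergToRamified_injective [CharZero O] [IsReduced A] :
    Function.Injective (greenbergToRamified p π A) := by
  obtain ⟨e, he⟩ := exists_associated_pow p hπ.out
  refine (injective_iff_map_eq_zero _).2 fun t ht => ?_
  obtain ⟨x, rfl⟩ := exists_eq_sum_tmul_pow he t
  refine Finset.sum_eq_zero fun j hj => ?_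
  suffices x j = 0 by rw [this, TensorProduct.zero_tmul]
  rcases subsingleton_or_nontrivial A with h | h
  · ext n
    exact Subsingleton.elim _ _
  have : CharP A p := charP_of_injective_algebraMap (algebraMap (ResidueField O) A).injective p
  rw [greenbergToRamified_sum_tmul_pow] at ht
  exact eq_zero_of_sum_pow_mul_drinfeld he ht j (Finset.mem_range.1 hj)

end Comparison

/-- With `s = π` and `e = 1` an expansion is just the image of one element of `O`, so existence and
uniqueness are surjectivity and injectivity. Both `O / π` and `W_O(k) / π` are `k`, and the tensor
product plays no role. -/
theorem algebraMap_ramifiedWittVector_residueField_bijective {O : Type*} [CommRing O] [IsDomain O]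
    [IsDiscreteValuationRing O] [Finite (ResidueField O)] [IsAdicComplete (maximalIdeal O) O]
    (π : O) [hπ : Fact (Irreducible π)] :
    Function.Bijective (algebraMap O (RamifiedWittVector π (ResidueField O))) := by
  obtain ⟨p, hchar⟩ := CharP.exists (ResidueField O)
  have : Fact p.Prime := ⟨CharP.char_is_prime (ResidueField O) p⟩
  have h0 := algebraMap_uniformizer_eq_zero (ResidueField O) hπ.out
  have hdvd := RamifiedWittVector.algebraMap_dvd_iff (π := π) h0
    (isSemiperfect_of_finite_field p (ResidueField O)).pow_residueCard_surjective
  have hreg := RamifiedWittVector.isLeftRegular_algebraMap (π := π) h0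
  constructor
  · refine (injective_iff_map_eq_zero _).2 fun c hc => ?_
    refine eq_zero_of_sum_pow_mul_eq_zero (algebraMap O (RamifiedWittVector π (ResidueField O)))
      (s := π) (e := 1) (x := fun _ => c) hreg (pow_one _).dvd hreg (fun y hy => ?_)
      (fun y hy => ?_) (by simpa using hc) 0 one_pos
    · refine IsHausdorff.haus (I := maximalIdeal O) inferInstance y fun n => ?_
      rw [SModEq.zero, smul_eq_mul, Ideal.mul_top, hπ.out.maximalIdeal_eq,
        Ideal.span_singleton_pow, Ideal.mem_span_singleton]
      exact hy n
    · rw [hdvd, RamifiedWittVector.coeffZero_algebraMap] at hy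
      exact (dvd_iff_residue_eq_zero hπ.out y).2 hy
  · intro y
    obtain ⟨x, hx⟩ := exists_eq_sum_pow_mul
      (algebraMap O (RamifiedWittVector π (ResidueField O))) (s := π) (e := 1)
      (hπ.out.maximalIdeal_eq ▸ inferInstance) (pow_one _).symm.dvd dvd_rfl
      (RamifiedWittVector.eq_zero_of_forall_pow_dvd h0) (fun y => by
        obtain ⟨c, hc⟩ := residue_surjective (RamifiedWittVector.coeffZero y)
        refine ⟨c, (hdvd _).2 ?_⟩
        rw [map_sub, RamifiedWittVector.coeffZero_algebraMap, ResidueField.algebraMap_eq, hc,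
          sub_self]) y
    exact ⟨x 0, by simpa using hx.symm⟩

/-- For a `k`-algebra `A` (an `O`-algebra whose structure map factors through the residue field `k`
of `O`), the map `r_A : W(A) ⊗_{W(k)} O → W_O(A)` is injective, surjective, bijective if `A` is
reduced, semiperfect, perfect, respectively; moreover `O → W_O(k)` is an isomorphism. -/
theorem lemma5p1 {O : Type*} [CommRing O] [IsDomain O] [IsDiscreteValuationRing O] [CharZero O]
    [IsAdicComplete (IsLocalRing.maximalIdeal O) O] [Finite (IsLocalRing.ResidueField O)]
    (p : ℕ) [Fact p.Prime] [CharP (IsLocalRing.ResidueField O) p]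
    (π : O) [Fact (Irreducible π)] :
    (∀ (A : Type*) [CommRing A] [Algebra O A] [Algebra (IsLocalRing.ResidueField O) A]
        [IsScalarTower O (IsLocalRing.ResidueField O) A],
      (IsReduced A → Function.Injective (greenbergToRamified p π A)) ∧
      (IsSemiperfect p A → Function.Surjective (greenbergToRamified p π A)) ∧
      (IsPerfect p A → Function.Bijective (greenbergToRamified p π A))) ∧
    Function.Bijective
      (algebraMap O (RamifiedWittVector π (IsLocalRing.ResidueField O))) := by
  refine ⟨fun A _ _ _ _ => ⟨fun _ => greenbergToRamified_injective p π A,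
    fun h => greenbergToRamified_surjective p π A h, fun h => ?_⟩,
    algebraMap_ramifiedWittVector_residueField_bijective π⟩
  have := h.isReduced (Fact.out : p.Prime)
  exact ⟨greenbergToRamified_injective p π A, greenbergToRamified_surjective p π A h.2⟩
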